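/- **Definitions.** An orientation of the $n$-dimensional hypercube is given by an outmap function $o:\{0,1\}^n\to\{0,1\}^n$ with $o(v)_i\neq o(v\oplus e_i)_i$ for all $v$ and $i$; the edge between $v$ and $v\oplus e_i$ is directed away from $v$ iff $o(v)_i=1$. It is a unique sink orientation (USO) if every non-empty face has exactly one vertex without outgoing edges inside the face. It is a Matoušek-type USO if, over $GF(2)$, $o(v)=PAP^T(v\oplus s)$ for all $v$, for some permutation matrix $P$, some invertible upper-triangular $A\in\{0,1\}^{n\times n}$ and some $s\in\{0,1\}^n$. A USO $o$ is realizable if there are a P-matrix $M\in\mathbb R^{n\times n}$ (all principal minors positive) and a vector $q\in\mathbb R^n$ such that the following holds, where for $v\in\{0,1\}^n$ the matrix $B_v$ has $j$-th column $-M_j$ if $v_j=1$ and $e_j$ if $v_j=0$: for all $v$ and $i$ we have $(B_v^{-1}q)_i\neq 0$ (non-degeneracy), and $o(v)_i=1$ iff $(B_v^{-1}q)_i<0$. (So $o$ is the USO of the linear complementarity problem $w-Mz=q$, $w,z\ge 0$, $w^Tz=0$.) A deterministic sink-finding algorithm in dimension $n$ has access to $o$ through queries only: a query $v\in\{0,1\}^n$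 is answered by $o(v)$. At each step the algorithm, as an arbitrary deterministic function of the queries and replies so far, either makes another query or halts and outputs a vertex. **Theorem.** Every deterministic algorithm needs $\Omega(\log n)$ queries in the worst case to find the sink of an $n$-dimensional realizable Matoušek-type USO. That is, there is an absolute constant $c>0$ such that for every $n\ge 1$ and every deterministic sink-finding algorithm $\mathcal A$ in dimension $n$ there is an $n$-dimensional realizable Matoušek-type USO $o$ such that, if $\mathcal A$ run on $o$ halts with the sink of $o$ as its output, then it has made at least $c\log n$ queries. (In particular, an algorithm that finds the sink of all $n$-dimensional realizable Matoušek-type USOs makes at least $c\log n$ queries on some of them.) -/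

import Mathlib

namespace CubeUSO

/-- The vertex set `{0,1}^n` of the `n`-dimensional hypercube, as vectors over `GF(2)`;
addition is bit-wise exclusive or. -/
abbrev Cube (n : ℕ) : Type := Fin n → ZMod 2

/-- `o` is (the outmap function of) an orientation of the `n`-cube: the edge between `v` and
`v ⊕ e_i` leaves `v` iff `o v i = 1`, and the two endpoints of each edge agree on its direction. -/
def IsOrientation {n : ℕ} (o : Cube n → Cube n) : Prop :=
  ∀ (v : Cube n) (i : Fin n), o v i ≠ o (v + Pi.single i 1) i

/-- `o` is a unique sink orientation: an orientation such that in each non-empty face (given by a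
base vertex `a` and the set `I` of dimensions spanning it) exactly one vertex has no outgoing edge
within the face. -/
def IsUSO {n : ℕ} (o : Cube n → Cube n) : Prop :=
  IsOrientation o ∧
    ∀ (a : Cube n) (I : Finset (Fin n)),
      ∃! v : Cube n, (∀ i, i ∉ I → v i = a i) ∧ ∀ i ∈ I, o v i = 0

/-- `o` is a Matoušek-type USO: `o v = M (v ⊕ s)` with `M = P A Pᵀ`, for a permutation matrix `P`,
an invertible upper-triangular matrix `A` over `GF(2)` and a vertex `s`. -/
def IsMatousekType {n : ℕ} (o : Cube n → Cube n) : Prop :=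
  ∃ (σ : Equiv.Perm (Fin n)) (A : Matrix (Fin n) (Fin n) (ZMod 2)) (s : Cube n),
    IsUnit A ∧ (∀ i j, j < i → A i j = 0) ∧
      ∀ v : Cube n,
        o v = (σ.permMatrix (ZMod 2) * A * (σ.permMatrix (ZMod 2)).transpose).mulVec (v + s)

/-- `M` is a P-matrix: all its principal minors are positive. -/
def IsPMatrix {n : ℕ} (M : Matrix (Fin n) (Fin n) ℝ) : Prop :=
  ∀ S : Finset (Fin n),
    0 < (M.submatrix (fun i : S => (i : Fin n)) (fun i : S => (i : Fin n))).det

/-- For the linear complementarity problem `w - M z = q`, `w ≥ 0`, `z ≥ 0`, `wᵀ z = 0`, the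
matrix of the basis chosen by the vertex `v`: column `j` is the column `-M_j` of the variable `z_j`
if `v j = 1`, and the column `e_j` of the variable `w_j` otherwise. -/
def basisMatrix {n : ℕ} (M : Matrix (Fin n) (Fin n) ℝ) (v : Cube n) :
    Matrix (Fin n) (Fin n) ℝ :=
  Matrix.of fun i j => if v j = 1 then -M i j else if i = j then 1 else 0

/-- The values of the basic variables in the basic solution at `v`. (If `M` is a P-matrix, the
basis matrix is invertible, its determinant being plus or minus a principal minor of `M`.) -/
noncomputable def basicSolution {n : ℕ} (M : Matrix (Fin n) (Fin n) ℝ) (q : Fin n → ℝ)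
    (v : Cube n) : Fin n → ℝ :=
  (basisMatrix M v)⁻¹.mulVec q

/-- The orientation that the linear complementarity problem `(M, q)` induces on the cube: the edge
in dimension `i` leaves `v` iff the `i`-th basic variable is negative in the basic solution at `v`.
Thus a sink is a basis whose basic solution solves the problem. -/
noncomputable def lcpOrientation {n : ℕ} (M : Matrix (Fin n) (Fin n) ℝ) (q : Fin n → ℝ) :
    Cube n → Cube n :=
  fun v i => if basicSolution M q v i < 0 then 1 else 0

/-- `o` is a realizable USO: a USO induced by a linear complementarity problem `(M, q)` with a
P-matrix `M` which is non-degenerate, i.e. no basic variable ever vanishes. -/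
def IsRealizable {n : ℕ} (o : Cube n → Cube n) : Prop :=
  IsUSO o ∧
    ∃ (M : Matrix (Fin n) (Fin n) ℝ) (q : Fin n → ℝ),
      IsPMatrix M ∧ (∀ v i, basicSolution M q v i ≠ 0) ∧ o = lcpOrientation M q

/-- A deterministic sink-finding algorithm on the `n`-cube, with unbounded computation and memory:
given the history of all queries made and replies received so far (in order), it either
queries a vertex (`Sum.inl v`) or halts with a vertex as its answer (`Sum.inr s`). -/
abbrev SinkFindingAlgorithm (n : ℕ) : Type := List (Cube n × Cube n) → Cube n ⊕ Cube n

/-- `IsHistory A o h`: the history `h` occurs when `A` runs with the vertex evaluation oracle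
of `o`. -/
inductive IsHistory {n : ℕ} (A : SinkFindingAlgorithm n) (o : Cube n → Cube n) :
    List (Cube n × Cube n) → Prop
  | start : IsHistory A o []
  | query (h : List (Cube n × Cube n)) (v : Cube n) :
      IsHistory A o h → A h = Sum.inl v → IsHistory A o (h ++ [(v, o v)])

/-- Run on `o`, the algorithm `A` makes exactly `k` queries and then halts with a sink of `o` as
its answer. (The answer itself need not have been queried.) -/
def FindsSinkWithQueries {n : ℕ} (A : SinkFindingAlgorithm n) (o : Cube n → Cube n)
    (k : ℕ) : Prop :=
  ∃ (h : List (Cube n × Cube n)) (s : Cube n),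
    IsHistory A o h ∧ h.length = k ∧ A h = Sum.inr s ∧ ∀ i, o s i = 0

end CubeUSO

/-!
The lower bound already holds for Klee–Minty cubes with an unknown order of the coordinates. For
a linear order on the coordinates, let the edge in dimension `i` leave `v` iff `v` has evenly many
ones at or before `i`. The outmap is `v ↦ T (v + e)`, where `T` is the matrix of the order and `e` is
the unit vector at the first coordinate; so it is of Matoušek type, and finding its sink `e` means
finding the first coordinate (`isMatousekType_kleeMinty`). It is realized by Murty's linear
complementarity problem: the matrix is triangular along the order, with ones on the diagonal and
twos below it, the right-hand side is constantly `-1`, and every basic solution is a vector of signs,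
because the partial sums in forward substitution telescope (`isRealizable_kleeMinty`).

The adversary keeps the coordinates in non-empty blocks, each with a fixed internal order, followed
by a fixed list of further coordinates, such that every query so far has an even number of ones in
each block. The replies then do not depend on how the blocks are arranged
(`prefixSum_flatten_append_perm`), so the first coordinate is undetermined as long as there are two
blocks. A new query may have an odd number of ones in some blocks; these are joined in pairs, and
one that is left over goes to the fixed list (`exists_zero_sum_groups`). As this roughly halves the
number of blocks at worst, at least `⌊n / 2 ^ k⌋` blocks remain after `k` queries, and an algorithm
that is always right needs at least `⌊log₂ n⌋` queries. The algorithm is deterministic, so its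
history on the orientation that the adversary chooses in the end is the one it has been shown.
-/

namespace CubeUSO

/-! ### Klee–Minty orientations -/

/-- The Klee–Minty orientation for the linear order on the coordinates in which `i` has position
`σ i`: an edge in dimension `i` leaves `v` iff `v` has evenly many ones at or before `i`. -/
def kleeMinty {n : ℕ} (σ : Equiv.Perm (Fin n)) : Cube n → Cube n :=
  fun v i => 1 + ∑ j, if σ j ≤ σ i then v j else 0

/-- If `v` and `w` agree at all positions before `i`, then `kleeMinty σ v i` determines `v i`. -/
lemma kleeMinty_inj_at {n : ℕ} (σ : Equiv.Perm (Fin n)) {v w : Cube n} {i : Fin n}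
    (hlt : ∀ j, σ j < σ i → v j = w j) (h : kleeMinty σ v i = kleeMinty σ w i) : v i = w i := by
  have split : ∀ u : Cube n,
      kleeMinty σ u i = 1 + (u i + ∑ j ∈ Finset.univ.erase i, if σ j ≤ σ i then u j else 0) := by
    intro u
    rw [kleeMinty, ← Finset.add_sum_erase _ _ (Finset.mem_univ i)]
    simp
  have hrest : ∑ j ∈ Finset.univ.erase i, (if σ j ≤ σ i then v j else 0) =
      ∑ j ∈ Finset.univ.erase i, if σ j ≤ σ i then w j else 0 := by
    refine Finset.sum_congr rfl fun j hj => ?_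
    split_ifs with hle
    · exact hlt j (lt_of_le_of_ne hle fun e => (Finset.ne_of_mem_erase hj) (σ.injective e))
    · rfl
  rw [split, split, hrest] at h
  exact add_right_cancel (add_left_cancel h)

lemma isUSO_kleeMinty {n : ℕ} (σ : Equiv.Perm (Fin n)) : IsUSO (kleeMinty σ) := by
  refine ⟨fun v i h => ?_, fun a I => ?_⟩
  · have h' := kleeMinty_inj_at σ (fun j hj => ?_) h
    · simp at h'
    · have : j ≠ i := by rintro rfl; exact lt_irrefl _ hj
      simp [this]
  · -- Replacing the coordinates in `I` by the outmap values there is a bijection of the cube.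
    let Φ : Cube n → Cube n := fun v i => if i ∈ I then kleeMinty σ v i else v i
    have hinj : Function.Injective Φ := by
      intro v w hvw
      have key : ∀ (p : ℕ) (i : Fin n), (σ i : ℕ) = p → v i = w i := by
        intro p
        induction p using Nat.strong_induction_on with
        | _ p ih =>
          intro i hi
          have hΦ : Φ v i = Φ w i := congrFun hvw i
          by_cases hiI : i ∈ I
          · simp only [Φ, hiI, if_true] at hΦ
            exact kleeMinty_inj_at σ (fun j hj => ih _ (hi ▸ hj) j rfl) hΦ
          · simpa only [Φ, hiI, if_false] using hΦ
      exact funext fun i => key _ i rfl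
    have hiff : ∀ v : Cube n, ((∀ i, i ∉ I → v i = a i) ∧ ∀ i ∈ I, kleeMinty σ v i = 0) ↔
        Φ v = fun i => if i ∈ I then 0 else a i := by
      intro v
      constructor
      · rintro ⟨h1, h2⟩
        funext i
        by_cases hi : i ∈ I
        · simp [Φ, hi, h2 i hi]
        · simp [Φ, hi, h1 i hi]
      · intro h
        exact ⟨fun i hi => by simpa [Φ, hi] using congrFun h i,
          fun i hi => by simpa [Φ, hi] using congrFun h i⟩
    simp only [hiff]
    exact (Finite.injective_iff_bijective.mp hinj).existsUnique _

lemma isMatousekType_kleeMinty {n : ℕ} (hn : 0 < n) (σ : Equiv.Perm (Fin n)) :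
    IsMatousekType (kleeMinty σ) := by
  -- `A` is triangular for the reversed order, and the sink is the unit vector at position zero.
  let A : Matrix (Fin n) (Fin n) (ZMod 2) := Matrix.of fun i j => if i ≤ j then 1 else 0
  have htri : ∀ i j, j < i → A i j = 0 := fun i j hij => by simp [A, hij]
  let τ : Equiv.Perm (Fin n) := σ.trans Fin.revPerm
  refine ⟨τ, A, Pi.single (σ.symm ⟨0, hn⟩) 1, ?_, htri, fun v => ?_⟩
  · rw [Matrix.isUnit_iff_isUnit_det,
      Matrix.det_of_isUpperTriangular (M := A) (fun i j h => htri i j h)]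
    simp [A]
  · funext i
    have hent : ∀ j, (τ.permMatrix (ZMod 2) * A * (τ.permMatrix (ZMod 2)).transpose) i j =
        if σ j ≤ σ i then 1 else 0 := by
      intro j
      simp [A, τ, Matrix.mul_apply, -Matrix.transpose_permMatrix, Equiv.Perm.permMatrix,
        PEquiv.toMatrix_apply, Equiv.toPEquiv_apply]
      rw [Finset.sum_eq_single (σ i).rev]
      · simp
      · intro k _ hk
        simp [hk.symm]
      · simp
    simp only [Matrix.mulVec, dotProduct, hent, kleeMinty, Pi.add_apply, mul_add,
      Finset.sum_add_distrib]
    rw [add_comm]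
    congr 1
    · exact Finset.sum_congr rfl fun j _ => by split_ifs <;> simp
    · rw [Finset.sum_eq_single (σ.symm ⟨0, hn⟩)]
      · simp [Fin.le_def]
      · intro j _ hj
        simp [hj]
      · simp

/-! ### Realization by a linear complementarity problem -/

/-- Murty's matrix for the order given by `σ`: ones on the diagonal, and a two at `(i, j)` if `j`
comes before `i`. -/
def murtyMatrix {n : ℕ} (σ : Equiv.Perm (Fin n)) : Matrix (Fin n) (Fin n) ℝ :=
  Matrix.of fun i j => if σ j < σ i then 2 else if i = j then 1 else 0

/-- The determinant of a matrix which is lower triangular for the order induced by an injection. -/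
lemma det_of_triangular_along {ι α : Type*} [Fintype ι] [DecidableEq ι] [LinearOrder α]
    (f : ι → α) (hf : Function.Injective f) (N : Matrix ι ι ℝ)
    (h : ∀ i j, f i < f j → N i j = 0) : N.det = ∏ i, N i i := by
  let _ : LinearOrder ι := LinearOrder.lift' f hf
  exact Matrix.det_of_isLowerTriangular N fun i j hij => h i j hij

lemma isPMatrix_murtyMatrix {n : ℕ} (σ : Equiv.Perm (Fin n)) : IsPMatrix (murtyMatrix σ) := by
  intro S
  rw [det_of_triangular_along (fun i : S => σ i) (σ.injective.comp Subtype.val_injective)]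
  · simp [murtyMatrix]
  · intro i j hij
    have hne : (i : Fin n) ≠ j := fun e => by simp [e] at hij
    simp [murtyMatrix, not_lt.mpr hij.le, hne]

/-- The sign `(-1)^b` of a bit. -/
def bitSign (b : ZMod 2) : ℝ := if b = 0 then 1 else -1

lemma bitSign_add (a b : ZMod 2) : bitSign (a + b) = bitSign a * bitSign b := by
  have h : ∀ a : ZMod 2, a = 0 ∨ a = 1 := by decide
  have h11 : (1 : ZMod 2) + 1 = 0 := by decide
  rcases h a with rfl | rfl <;> rcases h b with rfl | rfl <;> simp [bitSign, h11]

lemma bitSign_ne_zero (b : ZMod 2) : bitSign b ≠ 0 := by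
  unfold bitSign; split_ifs <;> norm_num

lemma bitSign_neg_iff (b : ZMod 2) : bitSign b < 0 ↔ b = 1 := by
  have h : b = 0 ∨ b = 1 := by revert b; decide
  rcases h with rfl | rfl <;> simp [bitSign]

/-- A telescoping sum: at each one of `w` the sign of the partial sums flips. -/
lemma sum_range_bitSign (w : ℕ → ZMod 2) (k : ℕ) :
    ∑ p ∈ Finset.range k,
      (if w p = 1 then 2 * bitSign (1 + ∑ r ∈ Finset.range (p + 1), w r) else 0) =
      bitSign (1 + ∑ r ∈ Finset.range k, w r) + 1 := by
  induction k with
  | zero => simp [bitSign]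
  | succ k ih =>
    rw [Finset.sum_range_succ, ih, Finset.sum_range_succ w k, ← add_assoc, bitSign_add _ (w k)]
    have h : w k = 0 ∨ w k = 1 := by generalize w k = b; revert b; decide
    rcases h with h | h
    · simp [h, bitSign]
    · simp only [h, if_true]
      simp only [bitSign, one_ne_zero, if_false]
      ring

/-- The basic solution at `v` consists of the signs of the outmap at `v`. -/
lemma basisMatrix_mulVec_bitSign {n : ℕ} (σ : Equiv.Perm (Fin n)) (v : Cube n) :
    (basisMatrix (murtyMatrix σ) v).mulVec (fun i => bitSign (kleeMinty σ v i)) =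
      fun _ => -1 := by
  funext i
  -- `w p` is the bit of `v` at position `p`.
  let w : ℕ → ZMod 2 := fun p => if hp : p < n then v (σ.symm ⟨p, hp⟩) else 0
  have hw : ∀ j, w (σ j) = v j := fun j => by simp [w]
  have hsum : ∀ {β : Type} [AddCommMonoid β] (g : ℕ → β) (k : ℕ) (_ : k ≤ n),
      ∑ j : Fin n, (if (σ j : ℕ) < k then g (σ j) else 0) = ∑ p ∈ Finset.range k, g p := by
    intro β _ g k hk
    rw [Equiv.sum_comp σ (fun p : Fin n => if (p : ℕ) < k then g p else 0),
      Fin.sum_univ_eq_sum_range (fun p => if p < k then g p else 0), ← Finset.sum_filter]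
    refine Finset.sum_congr ?_ fun _ _ => rfl
    ext p
    simp only [Finset.mem_filter, Finset.mem_range]
    omega
  have hkm : ∀ j, kleeMinty σ v j = 1 + ∑ r ∈ Finset.range ((σ j : ℕ) + 1), w r := by
    intro j
    rw [kleeMinty, ← hsum w _ (σ j).isLt]
    simp only [hw, Fin.le_def, Nat.lt_succ_iff]
  have hbit : v i = 0 ∨ v i = 1 := by generalize v i = b; revert b; decide
  have hterm : ∀ j, basisMatrix (murtyMatrix σ) v i j * bitSign (kleeMinty σ v j) =
      -(if (σ j : ℕ) < σ i then
        (if w (σ j) = 1 then 2 * bitSign (1 + ∑ r ∈ Finset.range ((σ j : ℕ) + 1), w r) else 0)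
        else 0) + (if i = j then bitSign (v i) * bitSign (kleeMinty σ v i) else 0) := by
    intro j
    rw [← hkm, hw]
    by_cases hij : i = j
    · subst hij
      rcases hbit with h | h <;> simp [basisMatrix, murtyMatrix, h, bitSign]
    · by_cases hlt : σ j < σ i <;> by_cases hv : v j = 1 <;>
        simp [basisMatrix, murtyMatrix, hij, hlt, hv]
  simp only [Matrix.mulVec, dotProduct, hterm]
  rw [Finset.sum_add_distrib, Finset.sum_neg_distrib,
    hsum (fun p => if w p = 1 then 2 * bitSign (1 + ∑ r ∈ Finset.range (p + 1), w r) else 0)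
      _ (σ i).isLt.le, sum_range_bitSign]
  have hlast : bitSign (v i) * bitSign (kleeMinty σ v i) =
      bitSign (1 + ∑ r ∈ Finset.range (σ i : ℕ), w r) := by
    rw [hkm, Finset.sum_range_succ, hw, ← add_assoc, bitSign_add _ (v i)]
    rcases hbit with h | h <;> simp only [h, bitSign, one_ne_zero, if_true, if_false] <;> ring
  simp [hlast]

lemma isRealizable_kleeMinty {n : ℕ} (σ : Equiv.Perm (Fin n)) : IsRealizable (kleeMinty σ) := by
  have hsol : ∀ v, basicSolution (murtyMatrix σ) (fun _ => -1) v =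
      fun i => bitSign (kleeMinty σ v i) := by
    intro v
    have hunit : IsUnit (basisMatrix (murtyMatrix σ) v).det := by
      rw [det_of_triangular_along σ σ.injective]
      · refine isUnit_iff_ne_zero.mpr (Finset.prod_ne_zero_iff.mpr fun i _ => ?_)
        by_cases h : v i = 1 <;> simp [basisMatrix, murtyMatrix, h]
      · intro i j hij
        have hne : i ≠ j := fun e => by simp [e] at hij
        simp [basisMatrix, murtyMatrix, not_lt.mpr hij.le, hne]
    rw [basicSolution, ← basisMatrix_mulVec_bitSign σ v, Matrix.mulVec_mulVec,
      Matrix.nonsing_inv_mul _ hunit, Matrix.one_mulVec]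
  refine ⟨isUSO_kleeMinty σ, murtyMatrix σ, fun _ => -1, isPMatrix_murtyMatrix σ, ?_, ?_⟩
  · intro v i
    rw [hsol]
    exact bitSign_ne_zero _
  · funext v i
    have hbit : kleeMinty σ v i = 0 ∨ kleeMinty σ v i = 1 := by
      generalize kleeMinty σ v i = b; revert b; decide
    simp only [lcpOrientation, hsol, bitSign_neg_iff]
    rcases hbit with h | h <;> simp [h]

/-! ### Orders given by lists -/

/-- The sum of the values of `v` along the list, up to and including the entry `i` (along the whole
list if `i` does not occur). -/
def prefixSum {α : Type*} [DecidableEq α] (v : α → ZMod 2) : List α → α → ZMod 2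
  | [], _ => 0
  | a :: L, i => v a + if a = i then 0 else prefixSum v L i

lemma prefixSum_append {α : Type*} [DecidableEq α] (v : α → ZMod 2) (L L' : List α) (i : α) :
    prefixSum v (L ++ L') i =
      if i ∈ L then prefixSum v L i else (L.map v).sum + prefixSum v L' i := by
  induction L with
  | nil => simp
  | cons a L ih =>
    by_cases h : a = i
    · simp [prefixSum, h]
    · have h' : i ≠ a := Ne.symm h
      simp only [List.cons_append, prefixSum, h, if_false, ih, List.mem_cons, h', false_or,
        List.map_cons, List.sum_cons]
      split_ifs <;> ring

lemma prefixSum_eq_sum_map {α : Type*} [DecidableEq α] (v : α → ZMod 2) (L : List α)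
    (hL : L.Nodup) (i : α) :
    prefixSum v L i = (L.map fun j => if L.idxOf j ≤ L.idxOf i then v j else 0).sum := by
  induction L with
  | nil => rfl
  | cons a L ih =>
    obtain ⟨haL, hL'⟩ := List.nodup_cons.mp hL
    have hne : ∀ j ∈ L, a ≠ j := fun j hj e => haL (e ▸ hj)
    simp only [prefixSum, List.map_cons, List.sum_cons, List.idxOf_cons_self, Nat.zero_le, if_true]
    congr 1
    by_cases h : a = i
    · subst h
      rw [if_pos rfl, eq_comm]
      refine List.sum_eq_zero fun x hx => ?_
      obtain ⟨j, hj, rfl⟩ := List.mem_map.mp hx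
      simp [List.idxOf_cons_ne _ (hne j hj)]
    · rw [if_neg h, ih hL']
      congr 1
      refine List.map_congr_left fun j hj => ?_
      simp [List.idxOf_cons_ne _ (hne j hj), List.idxOf_cons_ne _ h]

/-- The Klee–Minty orientation for the order in which the coordinates are listed in `L`. -/
def listOrientation {n : ℕ} (L : List (Fin n)) : Cube n → Cube n :=
  fun v i => 1 + prefixSum v L i

lemma exists_kleeMinty_eq_listOrientation {n : ℕ} {L : List (Fin n)}
    (hL : L.Perm (List.finRange n)) :
    ∃ σ : Equiv.Perm (Fin n), kleeMinty σ = listOrientation L := by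
  have hnd : L.Nodup := hL.nodup_iff.mpr (List.nodup_finRange n)
  have hmem : ∀ i, i ∈ L := fun i => hL.mem_iff.mpr (List.mem_finRange i)
  have hlen : L.length = n := by simpa using hL.length_eq
  let f : Fin n → Fin n := fun i => ⟨L.idxOf i, (List.idxOf_lt_length_of_mem (hmem i)).trans_eq hlen⟩
  have hf : Function.Injective f := fun i j h =>
    (List.idxOf_inj (hmem i)).mp (Fin.mk.inj h)
  refine ⟨Equiv.ofBijective f (Finite.injective_iff_bijective.mp hf), ?_⟩
  funext v i
  rw [listOrientation, prefixSum_eq_sum_map v L hnd, (hL.map _).sum_eq, ← Fin.sum_univ_def]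
  rfl

/-- If all prefix sums of `s` are one, then `s` is one at the head of the list only: the sink of
`listOrientation L` is the unit vector at the head of `L`. -/
lemma eq_zero_of_prefixSum_eq_one {α : Type*} [DecidableEq α] (s : α → ZMod 2) (a : α) (L : List α)
    (hnd : (a :: L).Nodup) (h : ∀ i ∈ a :: L, prefixSum s (a :: L) i = 1) :
    s a = 1 ∧ ∀ i ∈ L, s i = 0 := by
  have ha : s a = 1 := by simpa [prefixSum] using h a (by simp)
  obtain ⟨haL, hL⟩ := List.nodup_cons.mp hnd
  have hz : ∀ i ∈ L, prefixSum s L i = 0 := by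
    intro i hi
    have hne : a ≠ i := fun e => haL (e ▸ hi)
    simpa [prefixSum, hne, ha] using h i (List.mem_cons_of_mem _ hi)
  refine ⟨ha, ?_⟩
  clear h hnd haL ha
  induction L with
  | nil => simp
  | cons b L ih =>
    obtain ⟨hbL, hL'⟩ := List.nodup_cons.mp hL
    have hb : s b = 0 := by simpa [prefixSum] using hz b (by simp)
    intro i hi
    rcases List.mem_cons.mp hi with rfl | hi
    · exact hb
    · refine ih hL' (fun j hj => ?_) i hi
      have hne : b ≠ j := fun e => hbL (e ▸ hj)
      simpa [prefixSum, hne, hb] using hz j (List.mem_cons_of_mem _ hj)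

/-! ### Blocks -/

/-- If `v` sums to zero over every block, then its prefix sums do not depend on the order of the
blocks. -/
lemma prefixSum_flatten_append_perm {α : Type*} [DecidableEq α] (v : α → ZMod 2) (t : List α)
    {ℓ ℓ' : List (List α)} (hp : ℓ.Perm ℓ') (hnd : ℓ.flatten.Nodup)
    (hz : ∀ b ∈ ℓ, (b.map v).sum = 0) (i : α) :
    prefixSum v (ℓ.flatten ++ t) i = prefixSum v (ℓ'.flatten ++ t) i := by
  induction hp with
  | nil => rfl
  | cons b _ ih =>
    rw [List.flatten_cons, List.append_assoc, List.flatten_cons, List.append_assoc,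
      prefixSum_append v b, prefixSum_append v b,
      ih (List.nodup_append.mp hnd).2.1 fun c hc => hz c (List.mem_cons_of_mem _ hc)]
  | swap b c l =>
    simp only [List.flatten_cons, List.append_assoc, prefixSum_append]
    have hb := hz b (by simp)
    have hc := hz c (by simp)
    have hdisj : i ∈ b → i ∉ c := by
      intro hib hic
      rw [List.flatten_cons, List.flatten_cons] at hnd
      exact List.disjoint_of_nodup_append hnd hic (List.mem_append_left _ hib)
    by_cases hib : i ∈ b
    · simp [hib, hdisj hib, hc]
    · by_cases hic : i ∈ c <;> simp [hib, hic, hb, hc]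
  | trans hp₁ _ ih₁ ih₂ =>
    rw [ih₁ hnd hz, ih₂ (hp₁.flatten.nodup_iff.mp hnd) fun c hc => hz c (hp₁.mem_iff.mpr hc)]

/-- Blocks can be grouped so that `v` sums to zero over each group, by pairing up the blocks over
which the sum is one; at most one block is left over, and no group has more than two blocks. -/
lemma exists_zero_sum_groups {α : Type*} (v : α → ZMod 2) (ℓ : List (List α)) :
    ∃ (G : List (List (List α))) (r : List (List α)),
      (G.flatten ++ r).Perm ℓ ∧ (∀ g ∈ G, g ≠ [] ∧ (g.flatten.map v).sum = 0) ∧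
        (r = [] ∨ ∃ b, r = [b] ∧ (b.map v).sum = 1) ∧ ℓ.length ≤ 2 * G.length + r.length := by
  induction ℓ with
  | nil => exact ⟨[], [], by simp⟩
  | cons b ℓ ih =>
    obtain ⟨G, r, hp, hG, hr, hlen⟩ := ih
    have hbit : (b.map v).sum = 0 ∨ (b.map v).sum = 1 := by
      generalize (b.map v).sum = x; revert x; decide
    rcases hbit with hb | hb
    · refine ⟨[b] :: G, r, by simpa using hp, ?_, hr, by simp; omega⟩
      intro g hg
      rcases List.mem_cons.mp hg with rfl | hg
      · simpa using hb
      · exact hG g hg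
    · rcases hr with rfl | ⟨c, rfl, hc⟩
      · refine ⟨G, [b], ?_, hG, Or.inr ⟨b, rfl, hb⟩, by simp at hlen ⊢; omega⟩
        exact List.perm_append_comm.trans (by simpa using hp)
      · refine ⟨[b, c] :: G, [], ?_, ?_, Or.inl rfl, by simp at hlen ⊢; omega⟩
        · simpa using (List.perm_append_comm (l₁ := [c]) (l₂ := G.flatten)).trans hp
        · intro g hg
          rcases List.mem_cons.mp hg with rfl | hg
          · have h11 : (1 : ZMod 2) + 1 = 0 := by decide
            simp [hb, hc, h11]
          · exact hG g hg

/-! ### Histories of deterministic algorithms -/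

lemma IsHistory.of_prefix {n : ℕ} {A : SinkFindingAlgorithm n} {o : Cube n → Cube n}
    {h : List (Cube n × Cube n)} (hh : IsHistory A o h) {g : List (Cube n × Cube n)}
    {x : Cube n × Cube n} (hg : g ++ [x] <+: h) : A g = Sum.inl x.1 ∧ x.2 = o x.1 := by
  induction hh with
  | start => simp at hg
  | query h v _ hv ih =>
    rcases List.prefix_concat_iff.mp hg with heq | hpre
    · obtain ⟨rfl, rfl⟩ := List.append_singleton_inj.mp heq
      exact ⟨hv, rfl⟩
    · exact ih hpre

/-- A halting history extends every other history. -/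
lemma IsHistory.prefix_of_halts {n : ℕ} {A : SinkFindingAlgorithm n} {o : Cube n → Cube n}
    {h h' : List (Cube n × Cube n)} {s : Cube n} (hh : IsHistory A o h) (hh' : IsHistory A o h')
    (hs : A h' = Sum.inr s) : h <+: h' := by
  induction hh with
  | start => exact List.nil_prefix
  | query h v _ hv ih =>
    obtain ⟨r, rfl⟩ := ih
    cases r with
    | nil => simp [hv] at hs
    | cons x r =>
      obtain ⟨h1, h2⟩ := hh'.of_prefix (g := h) (x := x) ⟨r, by simp⟩
      rw [hv] at h1
      obtain ⟨x1, x2⟩ := x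
      obtain rfl : v = x1 := Sum.inl.inj h1
      exact ⟨r, by simp [← h2]⟩

/-! ### The adversary -/

/-- What the adversary knows after the history `h`: the coordinates are arranged in non-empty
blocks `ℓ` followed by the list `t`, and the history occurs for the order obtained from any
arrangement of the blocks. -/
structure AdversaryState {n : ℕ} (A : SinkFindingAlgorithm n) (h : List (Cube n × Cube n))
    (ℓ : List (List (Fin n))) (t : List (Fin n)) : Prop where
  perm : (ℓ.flatten ++ t).Perm (List.finRange n)
  ne_nil : ∀ b ∈ ℓ, b ≠ []
  history : ∀ ℓ' : List (List (Fin n)), ℓ'.Perm ℓ →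
    IsHistory A (listOrientation (ℓ'.flatten ++ t)) h

lemma AdversaryState.query {n : ℕ} {A : SinkFindingAlgorithm n} {h : List (Cube n × Cube n)}
    {ℓ : List (List (Fin n))} {t : List (Fin n)} (hst : AdversaryState A h ℓ t) {v : Cube n}
    (hv : A h = Sum.inl v) :
    ∃ (r : Cube n) (ℓ₂ : List (List (Fin n))) (t₂ : List (Fin n)),
      AdversaryState A (h ++ [(v, r)]) ℓ₂ t₂ ∧ ℓ.length ≤ 2 * ℓ₂.length + 1 := by
  obtain ⟨G, r, hp, hG, hr, hlen⟩ := exists_zero_sum_groups v ℓ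
  have hflat : ∀ G' : List (List (List (Fin n))),
      (G'.map List.flatten).flatten ++ (r.flatten ++ t) = (G'.flatten ++ r).flatten ++ t := by
    intro G'
    rw [List.flatten_append, List.flatten_flatten, List.append_assoc]
  have hperm : ((G.map List.flatten).flatten ++ (r.flatten ++ t)).Perm (List.finRange n) := by
    rw [hflat]
    exact (hp.flatten.append_right t).trans hst.perm
  refine ⟨listOrientation ((G.map List.flatten).flatten ++ (r.flatten ++ t)) v,
    G.map List.flatten, r.flatten ++ t, ⟨hperm, ?_, ?_⟩, ?_⟩
  · intro b hb
    obtain ⟨g, hg, rfl⟩ := List.mem_map.mp hb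
    obtain ⟨c, hc⟩ := List.exists_mem_of_ne_nil g (hG g hg).1
    intro he
    exact hst.ne_nil c
      (hp.mem_iff.mp (List.mem_append_left _ (List.mem_flatten.mpr ⟨g, hg, hc⟩)))
      (List.flatten_eq_nil_iff.mp he c hc)
  · intro ℓ' hℓ'
    have hnd : (G.map List.flatten).flatten.Nodup :=
      (List.nodup_append.mp (hperm.nodup_iff.mpr (List.nodup_finRange n))).1
    have hreply : listOrientation ((G.map List.flatten).flatten ++ (r.flatten ++ t)) v =
        listOrientation (ℓ'.flatten ++ (r.flatten ++ t)) v := by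
      funext i
      rw [listOrientation, listOrientation,
        prefixSum_flatten_append_perm v _ hℓ'.symm hnd (fun b hb => ?_)]
      obtain ⟨g, hg, rfl⟩ := List.mem_map.mp hb
      exact (hG g hg).2
    rw [hreply]
    refine IsHistory.query _ _ ?_ hv
    obtain ⟨G', rfl, hG'⟩ := (congrFun₂ (List.eq_map_comp_perm List.flatten) ℓ' G).mpr hℓ'
    rw [hflat]
    exact hst.history _ ((hG'.flatten.append_right r).trans hp)
  · have : r.length ≤ 1 := by rcases hr with rfl | ⟨b, rfl, _⟩ <;> simp
    simp only [List.length_map]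
    omega

/-- If the algorithm halts while there are two blocks, then its answer is wrong for an order that
starts with one of them. -/
lemma AdversaryState.exists_of_halts {n : ℕ} {A : SinkFindingAlgorithm n}
    {h : List (Cube n × Cube n)} {ℓ : List (List (Fin n))} {t : List (Fin n)}
    (hst : AdversaryState A h ℓ t) {s : Cube n} (hs : A h = Sum.inr s) (h2 : 2 ≤ ℓ.length) :
    ∃ L : List (Fin n), L.Perm (List.finRange n) ∧
      ∀ k, ¬ FindsSinkWithQueries A (listOrientation L) k := by
  have hsink : ∀ ℓ' : List (List (Fin n)), ℓ'.Perm ℓ → ∀ k,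
      FindsSinkWithQueries A (listOrientation (ℓ'.flatten ++ t)) k →
        ∀ i, prefixSum s (ℓ'.flatten ++ t) i = 1 := by
    rintro ℓ' hℓ' k ⟨h', s', hh', -, hs', hsink⟩ i
    have hh := hst.history ℓ' hℓ'
    have heq : h = h' := (hh.prefix_of_halts hh' hs').eq_of_length_le
      (hh'.prefix_of_halts hh hs).length_le
    subst heq
    obtain rfl : s = s' := Sum.inr.inj (hs.symm.trans hs')
    have := hsink i
    rw [listOrientation] at this
    generalize prefixSum s (ℓ'.flatten ++ t) i = x at this ⊢
    revert x; decide
  obtain ⟨b, c, ℓ, rfl⟩ : ∃ b c ℓ₀, ℓ = b :: c :: ℓ₀ := by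
    match ℓ, h2 with
    | b :: c :: ℓ, _ => exact ⟨b, c, ℓ, rfl⟩
  have hsw : (c :: b :: ℓ).Perm (b :: c :: ℓ) := List.Perm.swap _ _ _
  have hperm' : ((c :: b :: ℓ).flatten ++ t).Perm (List.finRange n) :=
    (hsw.flatten.append_right t).trans hst.perm
  by_contra hcon
  push Not at hcon
  obtain ⟨k, hk⟩ := hcon _ hst.perm
  obtain ⟨k', hk'⟩ := hcon _ hperm'
  have hs1 := hsink _ (List.Perm.refl _) k hk
  have hs2 := hsink _ hsw k' hk'
  obtain ⟨x, b, rfl⟩ := List.exists_cons_of_ne_nil (hst.ne_nil b (by simp))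
  obtain ⟨y, c, rfl⟩ := List.exists_cons_of_ne_nil (hst.ne_nil c (by simp))
  have hy0 : s y = 0 := (eq_zero_of_prefixSum_eq_one s x _
    (hst.perm.nodup_iff.mpr (List.nodup_finRange n)) fun i _ => hs1 i).2 y (by simp)
  have hy1 : s y = 1 := (eq_zero_of_prefixSum_eq_one s y _
    (hperm'.nodup_iff.mpr (List.nodup_finRange n)) fun i _ => hs2 i).1
  exact zero_ne_one (hy0.symm.trans hy1)

lemma exists_wrong_or_adversaryState {n : ℕ} (A : SinkFindingAlgorithm n) (K : ℕ)
    (hK : 2 ^ K ≤ n) :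
    (∃ L : List (Fin n), L.Perm (List.finRange n) ∧
      ∀ k, ¬ FindsSinkWithQueries A (listOrientation L) k) ∨
    ∃ h ℓ t, AdversaryState A h ℓ t ∧ h.length = K ∧ n < 2 ^ K * (ℓ.length + 1) := by
  induction K with
  | zero =>
    have hflat : ((List.finRange n).map fun i => [i]).flatten = List.finRange n := by
      generalize List.finRange n = l
      induction l with
      | nil => rfl
      | cons a l ih => simp [ih]
    exact Or.inr ⟨[], (List.finRange n).map fun i => [i], [],
      ⟨by simp [hflat], by simp, fun _ _ => IsHistory.start⟩, rfl, by simp⟩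
  | succ K ih =>
    have hle : 2 ^ K * 2 ≤ n := by simpa [pow_succ] using hK
    rcases ih (by omega) with hL | ⟨h, ℓ, t, hst, hlen, hn⟩
    · exact Or.inl hL
    · rcases hA : A h with v | s
      · obtain ⟨r, ℓ₂, t₂, hst₂, hle₂⟩ := hst.query hA
        refine Or.inr ⟨_, ℓ₂, t₂, hst₂, by simp [hlen], lt_of_lt_of_le hn ?_⟩
        rw [pow_succ, mul_assoc]
        exact Nat.mul_le_mul_left _ (by omega)
      · have h2 : 2 < ℓ.length + 1 := lt_of_mul_lt_mul_left (hle.trans_lt hn) (Nat.zero_le _)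
        exact Or.inl (hst.exists_of_halts hA (by omega))

/-- Some order of the coordinates forces at least `⌊log₂ n⌋` queries. -/
lemma exists_listOrientation_log_le {n : ℕ} (hn : 1 ≤ n) (A : SinkFindingAlgorithm n) :
    ∃ L : List (Fin n), L.Perm (List.finRange n) ∧
      ∀ k, FindsSinkWithQueries A (listOrientation L) k → Nat.log 2 n ≤ k := by
  rcases exists_wrong_or_adversaryState A (Nat.log 2 n) (Nat.pow_log_le_self 2 (by omega)) with
    ⟨L, hL, hno⟩ | ⟨h, ℓ, t, hst, hlen, -⟩
  · exact ⟨L, hL, fun k hk => absurd hk (hno k)⟩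
  · refine ⟨_, hst.perm, ?_⟩
    rintro k ⟨h', s, hh', rfl, hs, -⟩
    rw [← hlen]
    exact ((hst.history ℓ (List.Perm.refl _)).prefix_of_halts hh' hs).length_le

end CubeUSO

theorem mainTheorem4 :
    ∃ c : ℝ, 0 < c ∧ ∀ n : ℕ, 1 ≤ n → ∀ A : CubeUSO.SinkFindingAlgorithm n,
      ∃ o : CubeUSO.Cube n → CubeUSO.Cube n,
        CubeUSO.IsMatousekType o ∧ CubeUSO.IsRealizable o ∧
          ∀ k : ℕ, CubeUSO.FindsSinkWithQueries A o k → c * Real.log n ≤ k := by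
  refine ⟨1 / 2, by norm_num, fun n hn A => ?_⟩
  obtain ⟨L, hL, hlog⟩ := CubeUSO.exists_listOrientation_log_le hn A
  obtain ⟨σ, hσ⟩ := CubeUSO.exists_kleeMinty_eq_listOrientation hL
  refine ⟨CubeUSO.listOrientation L, hσ ▸ CubeUSO.isMatousekType_kleeMinty hn σ,
    hσ ▸ CubeUSO.isRealizable_kleeMinty σ, fun k hk => ?_⟩
  have hk := hlog k hk
  have hlt : n < 2 ^ (k + 1) :=
    (Nat.lt_pow_succ_log_self (by norm_num) n).trans_le
      (Nat.pow_le_pow_right (by norm_num) (by omega))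
  -- For `n ≥ 2` the floor costs at most a factor of two, as `k + 1 ≤ 2 * k`.
  have hle : n ≤ 2 ^ (2 * k) := by
    rcases Nat.eq_zero_or_pos k with rfl | hpos
    · simpa using Nat.lt_succ_iff.mp hlt
    · exact hlt.le.trans (Nat.pow_le_pow_right (by norm_num) (by omega))
  have hreal : Real.log n ≤ 2 * k * Real.log 2 := by
    have h1 : Real.log n ≤ Real.log ((2 : ℝ) ^ (2 * k)) :=
      Real.log_le_log (by exact_mod_cast hn) (by exact_mod_cast hle)
    rw [Real.log_pow] at h1
    exact_mod_cast h1
  have hlog2 : Real.log 2 ≤ 1 := by linarith [Real.log_two_lt_d9]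
  nlinarith [mul_le_mul_of_nonneg_left hlog2 (Nat.cast_nonneg (α := ℝ) k)]
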